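/- Let $k$ be a commutative ring, $A$ a $k$-algebra and $C$ a $k$-coalgebra with comultiplication $\Delta(c)=c_{(1)}\otimes c_{(2)}$ and counit $\varepsilon$. Let $(A,C,\psi)$ be a (right-right) entwining structure, i.e. $\psi: C\otimes A\to A\otimes C$, $\psi(c\otimes a)=a_\psi\otimes c^\psi$ (different copies of $\psi$ are written $\psi,\Psi,\psi_1,\psi_2,\dots$), is a $k$-linear map such that, for all $a,b\in A$ and $c\in C$, $$(ab)_\psi\otimes c^\psi=a_\psi b_\Psi\otimes c^{\psi\Psi},\quad 1_\psi\otimes c^\psi=1\otimes c,\quad a_\psi\otimes\Delta(c^\psi)=a_{\psi\Psi}\otimes c_{(1)}^{\Psi}\otimes c_{(2)}^{\psi},\quad \varepsilon(c^\psi)a_\psi=\varepsilon(c)a .$$ An entwined module is a $k$-module $M$ which is a right $A$-module and a right $C$-comodule, with coaction $\rho(m)=m_{[0]}\otimes m_{[1]}$, such that $\rho(ma)=m_{[0]}a_\psi\otimes m_{[1]}^\psi$. Let $\mathcal M(\psi)_A^C$ be the category of entwined modules and $A$-linear $C$-colinear maps, and let $F:\mathcal M(\psi)_A^C\to\mathcal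 M_A$ and $H:\mathcal M(\psi)_A^C\to\mathcal M^C$ be the forgetful functors to right $A$-modules and to right $C$-comodules. A functor $F:\mathcal C\to\mathcal D$ is called $H$-separable, for a functor $H:\mathcal C\to\mathcal E$, if there is a natural transformation $\mathcal P:\mathrm{Hom}_{\mathcal D}(F,F)\to\mathrm{Hom}_{\mathcal E}(H,H)$ of functors $\mathcal C^{op}\times\mathcal C\to\mathrm{Sets}$ with $\mathcal P(F(f))=H(f)$ for all morphisms $f$ of $\mathcal C$; it is called separable if it is $1_{\mathcal C}$-separable. Assume that the pair consisting of $F$ and its right adjoint $G=\bullet\otimes C$ is Frobenius, with Frobenius system $(\theta,z)$; that is, $\theta:C\otimes C\to A$ is a $k$-linear map and $z=\sum_l a_l\otimes c_l\in A\otimes C$, such that for all $a\in A$ and $c,d\in C$ $$\theta(c\otimes d)a=a_{\psi\Psi}\theta(c^\Psi\otimes d^\psi),\qquad \theta(c\otimes d_{(1)})\otimes d_{(2)}=\theta(c_{(2)}\otimes d)_\psi\otimes c_{(1)}^\psi,$$ $$\sum_l aa_l\otimes c_l=\sum_l a_la_\psi\otimes c_l^\psi,\qquad \varepsilon(d)1=\sum_l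 a_l\theta(c_l\otimes d)=\sum_l a_{l\psi}\theta(d^\psi\otimes c_l).$$ Then: 1. $F$ is $H$-separable if and only if there exists a $k$-linear map $\beta:C\to A$ such that for all $c\in C$ $$\beta(c_{(3)})_{\psi_1\psi_2}\,\theta(c_{(2)}^{\psi_1}\otimes c_{(4)})_{\psi_3}\otimes c_{(1)}^{\psi_2\psi_3}=1\otimes c.\tag{$*$}$$ 2. $F$ is separable if and only if there exists a $k$-linear map $\beta:C\to A$ satisfying $(*)$ and $\beta(c)a=a_\psi\beta(c^\psi)$ for all $a\in A$, $c\in C$. -/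

import Mathlib

open CategoryTheory TensorProduct Coalgebra

universe u v

/-! ## Separable functors of the second kind -/

section Separability

universe v₁ v₂ v₃ u₁ u₂ u₃

variable {𝒞 : Type u₁} [Category.{v₁} 𝒞] {𝒟 : Type u₂} [Category.{v₂} 𝒟]
  {ℰ : Type u₃} [Category.{v₃} ℰ]

/-- `F` is `H`-separable: there is a natural transformation
`P : Hom_𝒟(F, F) → Hom_ℰ(H, H)` of functors `𝒞ᵒᵖ × 𝒞 → Sets` such that `P (F f) = H f` for every
morphism `f` of `𝒞`. -/
def IsHSeparable (F : 𝒞 ⥤ 𝒟) (H : 𝒞 ⥤ ℰ) : Prop :=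
  ∃ P : ∀ X Y : 𝒞, (F.obj X ⟶ F.obj Y) → (H.obj X ⟶ H.obj Y),
    (∀ (X Y Z T : 𝒞) (u : X ⟶ Y) (h : F.obj Y ⟶ F.obj Z) (w : Z ⟶ T),
      P X T (F.map u ≫ h ≫ F.map w) = H.map u ≫ P Y Z h ≫ H.map w) ∧
    ∀ (X Y : 𝒞) (f : X ⟶ Y), P X Y (F.map f) = H.map f

/-- `F` is separable: the natural transformation `Hom_𝒞(-, -) → Hom_𝒟(F, F)` induced by `F` has a
natural left inverse. -/
def IsSeparableFunctor (F : 𝒞 ⥤ 𝒟) : Prop :=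
  IsHSeparable F (𝟭 𝒞)

end Separability

/-! ## Right comodules over a coalgebra -/

section Comodules

variable (k : Type u) [CommRing k] (C : Type v) [AddCommGroup C] [Module k C] [Coalgebra k C]

/-- A right `C`-comodule: a `k`-module with a coassociative and counital coaction. -/
structure RightComodule where
  /-- The underlying type. -/
  carrier : Type v
  [addCommGroup : AddCommGroup carrier]
  [module : Module k carrier]
  /-- The coaction `m ↦ m₀ ⊗ m₁`. -/
  coact : carrier →ₗ[k] carrier ⊗[k] C
  coassoc : ∀ m, TensorProduct.assoc k carrier C C (coact.rTensor C (coact m)) =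
    (comul (R := k) (A := C)).lTensor carrier (coact m)
  counital : ∀ m, TensorProduct.rid k carrier
    ((counit (R := k) (A := C)).lTensor carrier (coact m)) = m

attribute [instance] RightComodule.addCommGroup RightComodule.module

end Comodules

namespace RightComodule

variable {k : Type u} [CommRing k] {C : Type v} [AddCommGroup C] [Module k C] [Coalgebra k C]

/-- A `C`-colinear map. -/
@[ext]
structure Hom (M N : RightComodule k C) where
  /-- The underlying `k`-linear map. -/
  linear : M.carrier →ₗ[k] N.carrier
  colinear : ∀ m, N.coact (linear m) = linear.rTensor C (M.coact m)

/-- The category of right `C`-comodules and `C`-colinear maps. -/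
instance : Category (RightComodule k C) where
  Hom M N := Hom M N
  id M := ⟨LinearMap.id, fun m => by simp⟩
  comp f g := ⟨g.linear ∘ₗ f.linear, fun m => by
    simp [f.colinear, g.colinear, LinearMap.rTensor_comp_apply]⟩

end RightComodule

/-! ## Entwining structures and entwined modules -/

section Entwining

variable (k : Type u) [CommRing k] (A : Type v) [Ring A] [Algebra k A]
  (C : Type v) [AddCommGroup C] [Module k C] [Coalgebra k C]

/-- A (right-right) entwining structure `(A, C, ψ)`, with `ψ (c ⊗ a) = a_ψ ⊗ c^ψ`. -/
structure EntwiningStructure where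
  /-- The entwining map. -/
  ψ : C ⊗[k] A →ₗ[k] A ⊗[k] C
  /-- `(ab)_ψ ⊗ c^ψ = a_ψ b_Ψ ⊗ c^{ψΨ}` -/
  map_mul : ∀ (c : C) (a b : A), ψ (c ⊗ₜ (a * b)) =
    (LinearMap.mul' k A).rTensor C ((TensorProduct.assoc k A A C).symm
      (ψ.lTensor A (TensorProduct.assoc k A C A (ψ (c ⊗ₜ a) ⊗ₜ b))))
  /-- `1_ψ ⊗ c^ψ = 1 ⊗ c` -/
  map_one : ∀ c : C, ψ (c ⊗ₜ 1) = 1 ⊗ₜ c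
  /-- `a_ψ ⊗ Δ(c^ψ) = a_{ψΨ} ⊗ c₁^Ψ ⊗ c₂^ψ` -/
  map_comul : ∀ (c : C) (a : A), (comul (R := k) (A := C)).lTensor A (ψ (c ⊗ₜ a)) =
    TensorProduct.assoc k A C C (ψ.rTensor C ((TensorProduct.assoc k C A C).symm
      (ψ.lTensor C (TensorProduct.assoc k C C A (comul (R := k) c ⊗ₜ a)))))
  /-- `ε(c^ψ) a_ψ = ε(c) a` -/
  map_counit : ∀ (c : C) (a : A),
    TensorProduct.rid k A ((counit (R := k) (A := C)).lTensor A (ψ (c ⊗ₜ a))) =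
      counit (R := k) c • a

/-- The action `m ⊗ a ↦ m a` of a right `A`-module, as a `k`-linear map. Right `A`-modules are
modules over the opposite algebra. -/
def rightAction (M : Type v) [AddCommGroup M] [Module k M] [Module Aᵐᵒᵖ M]
    [IsScalarTower k Aᵐᵒᵖ M] : M ⊗[k] A →ₗ[k] M :=
  TensorProduct.lift <| LinearMap.mk₂ k (fun (m : M) (a : A) => MulOpposite.op a • m)
    (fun m m' a => smul_add _ m m')
    (fun r m a => by
      rw [← algebraMap_smul Aᵐᵒᵖ r m, smul_smul, ← Algebra.commutes, ← smul_smul, algebraMap_smul])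
    (fun m a a' => by rw [MulOpposite.op_add, add_smul])
    (fun r m a => by rw [MulOpposite.op_smul, smul_assoc])

end Entwining

namespace EntwiningStructure

variable {k : Type u} [CommRing k] {A : Type v} [Ring A] [Algebra k A]
  {C : Type v} [AddCommGroup C] [Module k C] [Coalgebra k C]

/-- For a right `A`-module `M`, the right `A`-action `(m ⊗ c) a = m a_ψ ⊗ c^ψ` on `M ⊗ C`, as a
`k`-linear map `(m ⊗ c) ⊗ a ↦ m a_ψ ⊗ c^ψ`. -/
def tensorAction (E : EntwiningStructure k A C) (M : Type v) [AddCommGroup M] [Module k M]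
    [Module Aᵐᵒᵖ M] [IsScalarTower k Aᵐᵒᵖ M] : (M ⊗[k] C) ⊗[k] A →ₗ[k] M ⊗[k] C :=
  (rightAction k A M).rTensor C ∘ₗ (TensorProduct.assoc k M A C).symm.toLinearMap ∘ₗ
    E.ψ.lTensor M ∘ₗ (TensorProduct.assoc k M C A).toLinearMap

/-- An entwined module: a right `C`-comodule and right `A`-module (over the same `k`-module) with
`ρ(m a) = m₀ a_ψ ⊗ m₁^ψ`. -/
structure EntwinedModule (E : EntwiningStructure k A C) where
  /-- The underlying right `C`-comodule. -/
  toComodule : RightComodule k C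
  [opModule : Module Aᵐᵒᵖ toComodule.carrier]
  [isScalarTower : IsScalarTower k Aᵐᵒᵖ toComodule.carrier]
  compat : ∀ (m : toComodule.carrier) (a : A), toComodule.coact (MulOpposite.op a • m) =
    E.tensorAction toComodule.carrier (toComodule.coact m ⊗ₜ a)

attribute [instance] EntwinedModule.opModule EntwinedModule.isScalarTower

namespace EntwinedModule

variable {E : EntwiningStructure k A C}

/-- A morphism of entwined modules: an `A`-linear `C`-colinear map. -/
@[ext]
structure Hom (M N : EntwinedModule E) where
  /-- The underlying `C`-colinear map. -/
  toComoduleHom : M.toComodule ⟶ N.toComodule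
  map_op_smul : ∀ (a : Aᵐᵒᵖ) (m : M.toComodule.carrier),
    toComoduleHom.linear (a • m) = a • toComoduleHom.linear m

/-- The category `M(ψ)_A^C` of entwined modules. -/
instance : Category (EntwinedModule E) where
  Hom M N := Hom M N
  id M := ⟨𝟙 M.toComodule, fun _ _ => rfl⟩
  comp f g := ⟨f.toComoduleHom ≫ g.toComoduleHom, fun a m => by
    change g.toComoduleHom.linear (f.toComoduleHom.linear (a • m)) =
      a • g.toComoduleHom.linear (f.toComoduleHom.linear m)
    rw [f.map_op_smul, g.map_op_smul]⟩

end EntwinedModule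

variable (E : EntwiningStructure k A C)

/-- The functor `F : M(ψ)_A^C → M_A` forgetting the coaction. -/
def forgetToModule : EntwinedModule E ⥤ ModuleCat.{v} Aᵐᵒᵖ where
  obj M := ModuleCat.of Aᵐᵒᵖ M.toComodule.carrier
  map f := ModuleCat.ofHom
    { toFun := f.toComoduleHom.linear
      map_add' := f.toComoduleHom.linear.map_add
      map_smul' := f.map_op_smul }
  map_id _ := rfl
  map_comp _ _ := rfl

/-- The functor `H : M(ψ)_A^C → M^C` forgetting the `A`-action. -/
def forgetToComodule : EntwinedModule E ⥤ RightComodule k C where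
  obj M := M.toComodule
  map f := f.toComoduleHom
  map_id _ := rfl
  map_comp _ _ := rfl

/-- The map `c ⊗ (a ⊗ d) ↦ a_ψ θ(c^ψ ⊗ d)`. -/
noncomputable def psiTheta (θ : C ⊗[k] C →ₗ[k] A) : C ⊗[k] (A ⊗[k] C) →ₗ[k] A :=
  LinearMap.mul' k A ∘ₗ θ.lTensor A ∘ₗ (TensorProduct.assoc k A C C).toLinearMap ∘ₗ
    E.ψ.rTensor C ∘ₗ (TensorProduct.assoc k C A C).symm.toLinearMap

/-- A Frobenius system `(θ, z)`, `z = ∑ a_l ⊗ c_l`, for the forgetful functor `F` and its right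
adjoint `- ⊗ C`. -/
structure IsFrobeniusSystem (θ : C ⊗[k] C →ₗ[k] A) (z : A ⊗[k] C) : Prop where
  /-- `θ(c ⊗ d) a = a_{ψΨ} θ(c^Ψ ⊗ d^ψ)` -/
  theta_mul : ∀ (c d : C) (a : A), θ (c ⊗ₜ d) * a = E.psiTheta θ (c ⊗ₜ E.ψ (d ⊗ₜ a))
  /-- `θ(c ⊗ d₁) ⊗ d₂ = θ(c₂ ⊗ d)_ψ ⊗ c₁^ψ` -/
  theta_comul : ∀ c d : C,
    θ.rTensor C ((TensorProduct.assoc k C C C).symm (c ⊗ₜ comul (R := k) d)) =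
      E.ψ (θ.lTensor C (TensorProduct.assoc k C C C (comul (R := k) c ⊗ₜ d)))
  /-- `a z = z a`, that is `∑ a a_l ⊗ c_l = ∑ a_l a_ψ ⊗ c_l^ψ` -/
  central : ∀ a : A, (LinearMap.mulLeft k a).rTensor C z =
    (LinearMap.mul' k A).rTensor C ((TensorProduct.assoc k A A C).symm
      (E.ψ.lTensor A (TensorProduct.assoc k A C A (z ⊗ₜ a))))
  /-- `∑ a_l θ(c_l ⊗ d) = ε(d) 1` -/
  normal_left : ∀ d : C,
    LinearMap.mul' k A (θ.lTensor A (TensorProduct.assoc k A C C (z ⊗ₜ d))) =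
      algebraMap k A (counit (R := k) d)
  /-- `∑ (a_l)_ψ θ(d^ψ ⊗ c_l) = ε(d) 1` -/
  normal_right : ∀ d : C, E.psiTheta θ (d ⊗ₜ z) = algebraMap k A (counit (R := k) d)

/-- The iterated comultiplication `c ↦ c₁ ⊗ (c₂ ⊗ (c₃ ⊗ c₄))`. -/
noncomputable def comul₄ (k : Type u) [CommRing k] (C : Type v) [AddCommGroup C] [Module k C]
    [Coalgebra k C] : C →ₗ[k] C ⊗[k] (C ⊗[k] (C ⊗[k] C)) :=
  ((comul (R := k) (A := C)).lTensor C).lTensor C ∘ₗ (comul (R := k) (A := C)).lTensor C ∘ₗ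
    comul (R := k) (A := C)

/-- The map `c ↦ β(c₃)_{ψ₁ψ₂} θ(c₂^{ψ₁} ⊗ c₄)_{ψ₃} ⊗ c₁^{ψ₂ψ₃}`, from `C` to `A ⊗ C`. -/
noncomputable def separabilityMap (θ : C ⊗[k] C →ₗ[k] A) (β : C →ₗ[k] A) : C →ₗ[k] A ⊗[k] C :=
  -- multiply: `β(c₃)_{ψ₁ψ₂} θ(c₂^{ψ₁} ⊗ c₄)_{ψ₃} ⊗ c₁^{ψ₂ψ₃}`
  (LinearMap.mul' k A).rTensor C ∘ₗ (TensorProduct.assoc k A A C).symm.toLinearMap ∘ₗ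
    -- apply `ψ₃`: `β(c₃)_{ψ₁ψ₂} ⊗ (θ(c₂^{ψ₁} ⊗ c₄)_{ψ₃} ⊗ c₁^{ψ₂ψ₃})`
    E.ψ.lTensor A ∘ₗ
    -- apply `θ`: `β(c₃)_{ψ₁ψ₂} ⊗ (c₁^{ψ₂} ⊗ θ(c₂^{ψ₁} ⊗ c₄))`
    (θ.lTensor C).lTensor A ∘ₗ
    -- apply `ψ₂`: `β(c₃)_{ψ₁ψ₂} ⊗ (c₁^{ψ₂} ⊗ (c₂^{ψ₁} ⊗ c₄))`
    (TensorProduct.assoc k A C (C ⊗[k] C)).toLinearMap ∘ₗ E.ψ.rTensor (C ⊗[k] C) ∘ₗ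
    (TensorProduct.assoc k C A (C ⊗[k] C)).symm.toLinearMap ∘ₗ
    -- apply `ψ₁`: `c₁ ⊗ (β(c₃)_{ψ₁} ⊗ (c₂^{ψ₁} ⊗ c₄))`
    ((TensorProduct.assoc k A C C).toLinearMap ∘ₗ E.ψ.rTensor C ∘ₗ
      (TensorProduct.assoc k C A C).symm.toLinearMap).lTensor C ∘ₗ
    -- apply `β`: `c₁ ⊗ (c₂ ⊗ (β(c₃) ⊗ c₄))`
    ((β.rTensor C).lTensor C).lTensor C ∘ₗ comul₄ k C

end EntwiningStructure

/-! The functor `- ⊗ C` is right adjoint to `F`, with unit the coaction and counit `m ⊗ c ↦ ε(c) m`.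
As in Rafael's theorem, a natural `P` with `P (F f) = H f` is determined by its values `S_M : M ⊗ C
→ M` on the counits: naturality gives `P h = S ∘ (h ⊗ C) ∘ ρ`, and the normalization becomes `S_M ∘
ρ_M = id`. Hence `F` is `H`-separable iff there is a natural colinear splitting of the coactions
(`CoactionSplitting`), and separable iff there is one that is also `A`-linear.

The Frobenius system makes `- ⊗ C` a left adjoint of `F` too, with counit `m ⊗ c ↦ m₀ θ(m₁ ⊗ c)`
(`frobeniusCounit`) and unit `n ↦ n z`. So every `m : M` is the image of `z` under a morphism `A ⊗ C
⟶ M` (`elementHom`), and a splitting is determined by `c ↦ S(z ⊗ c)`. This map into the cofree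
comodule `A ⊗ C` is colinear, hence equals `c ↦ β(c₁) ⊗ c₂` for a unique `β`
(`sectionMap_eq_coextend`). Thus `S` is `frobeniusCounit` after `n ⊗ c ↦ n β(c₁) ⊗ c₂` (`map_eq`),
and conversely each such composite is natural and colinear.

It remains to translate two conditions. The map in `(*)` is `c ↦ ψ(c₁ ⊗ ν(c₂))` with `ν(c) = β(c₂)_ψ
θ(c₁^ψ ⊗ c₃)` (`separabilityMap_apply`); the splitting identity on `A ⊗ C` at `1 ⊗ c` is exactly
`(*)`, while `(*)` forces `ν = ε 1` and so the splitting identity on every `M`. Finally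
`A`-linearity of `S` matches `β(c) a = a_ψ β(c^ψ)`. -/

namespace EntwiningStructure

/-! ### The entwined module `N ⊗ C` of a right `A`-module `N`. -/

section Action

variable {k : Type u} [CommRing k] {A : Type v} [Ring A] [Algebra k A]
  {C : Type v} [AddCommGroup C] [Module k C] [Coalgebra k C]
  (E : EntwiningStructure k A C)
  {N : Type v} [AddCommGroup N] [Module k N] [Module Aᵐᵒᵖ N] [IsScalarTower k Aᵐᵒᵖ N]
  {N' : Type v} [AddCommGroup N'] [Module k N'] [Module Aᵐᵒᵖ N'] [IsScalarTower k Aᵐᵒᵖ N']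

/-- The `A`-linear map `A → N`, `a ↦ n a`. -/
def orbitMap (n : N) : A →ₗ[Aᵐᵒᵖ] N where
  toFun a := MulOpposite.op a • n
  map_add' a b := by rw [MulOpposite.op_add, add_smul]
  map_smul' a b := by
    rw [RingHom.id_apply, smul_smul]
    rfl

variable (k) in
/-- `orbitMap` as a `k`-linear map. -/
def orbit (n : N) : A →ₗ[k] N := (orbitMap n).restrictScalars k

@[simp]
theorem orbit_apply (n : N) (a : A) : orbit k n a = MulOpposite.op a • n := rfl

@[simp]
theorem rightAction_tmul (n : N) (a : A) :
    rightAction k A N (n ⊗ₜ a) = MulOpposite.op a • n := rfl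

theorem tensorAction_tmul (n : N) (c : C) (a : A) :
    E.tensorAction N ((n ⊗ₜ c) ⊗ₜ a) = (orbit k n).rTensor C (E.ψ (c ⊗ₜ a)) := by
  simp only [tensorAction, LinearMap.comp_apply, LinearEquiv.coe_coe, TensorProduct.assoc_tmul,
    LinearMap.lTensor_tmul]
  induction E.ψ (c ⊗ₜ a) with
  | zero => simp
  | add x y hx hy => simp only [tmul_add, map_add, hx, hy]
  | tmul a c => simp

/-- This is functoriality of `- ⊗ C`. Applied to `orbitMap n : A → N`, it reduces identities on `N ⊗
C` to the case `N = A`. -/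
theorem rTensor_tensorAction (h : N →ₗ[Aᵐᵒᵖ] N') (x : N ⊗[k] C) (a : A) :
    (h.restrictScalars k).rTensor C (E.tensorAction N (x ⊗ₜ a)) =
      E.tensorAction N' ((h.restrictScalars k).rTensor C x ⊗ₜ a) := by
  induction x with
  | zero => simp
  | add x y hx hy => simp only [add_tmul, map_add, hx, hy]
  | tmul n c =>
    simp only [tensorAction_tmul, LinearMap.rTensor_tmul]
    rw [← LinearMap.rTensor_comp_apply]
    congr 2
    ext a
    simp

/-- The multiplicativity axiom, read as right `A`-linearity of `ψ` from `C ⊗ A` to `A ⊗ C`. -/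
theorem map_mul_eq_tensorAction (c : C) (a b : A) :
    E.ψ (c ⊗ₜ (a * b)) = E.tensorAction A (E.ψ (c ⊗ₜ a) ⊗ₜ b) := by
  have h : LinearMap.mul' k A = rightAction k A A := by
    ext
    simp
  rw [E.map_mul, tensorAction, h]
  rfl

theorem tensorAction_one (x : N ⊗[k] C) : E.tensorAction N (x ⊗ₜ 1) = x := by
  induction x with
  | zero => simp
  | add x y hx hy => simp only [add_tmul, map_add, hx, hy]
  | tmul n c => simp [tensorAction_tmul, E.map_one]

theorem tensorAction_mul (x : N ⊗[k] C) (a b : A) :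
    E.tensorAction N (x ⊗ₜ (a * b)) = E.tensorAction N (E.tensorAction N (x ⊗ₜ a) ⊗ₜ b) := by
  induction x with
  | zero => simp
  | add x y hx hy => simp only [add_tmul, map_add, hx, hy]
  | tmul n c =>
    rw [tensorAction_tmul, map_mul_eq_tensorAction, tensorAction_tmul]
    exact E.rTensor_tensorAction (orbitMap n) _ b

/-- The cofree right `C`-comodule `N ⊗ C`. -/
noncomputable def cofreeComodule (k : Type u) [CommRing k] (C : Type v) [AddCommGroup C]
    [Module k C] [Coalgebra k C] (N : Type v) [AddCommGroup N] [Module k N] :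
    RightComodule k C where
  carrier := N ⊗[k] C
  coact := (TensorProduct.assoc k N C C).symm.toLinearMap ∘ₗ
    (comul (R := k) (A := C)).lTensor N
  coassoc x := by
    induction x with
    | zero => simp
    | add x y hx hy => simp only [map_add, hx, hy]
    | tmul n c =>
      have h := Coalgebra.coassoc_apply (R := k) c
      simp only [LinearMap.comp_apply, LinearMap.lTensor_tmul, LinearEquiv.coe_coe]
      trans (TensorProduct.assoc k N C (C ⊗[k] C)).symm
        (n ⊗ₜ TensorProduct.assoc k C C C ((comul (R := k)).rTensor C (comul (R := k) c)))
      · generalize comul (R := k) c = t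
        induction t with
        | zero => simp
        | add x y hx hy => simp only [tmul_add, map_add, hx, hy]
        | tmul d e =>
          simp only [TensorProduct.assoc_symm_tmul, LinearMap.rTensor_tmul, LinearMap.comp_apply,
            LinearMap.lTensor_tmul, LinearEquiv.coe_coe]
          generalize comul (R := k) d = t
          induction t with
          | zero => simp
          | add x y hx hy => simp only [tmul_add, add_tmul, map_add, hx, hy]
          | tmul d' e' => simp
      · rw [h]
        generalize comul (R := k) c = t
        induction t with
        | zero => simp
        | add x y hx hy => simp only [tmul_add, map_add, hx, hy]
        | tmul d e => simp
  counital x := by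
    induction x with
    | zero => simp
    | add x y hx hy => simp only [map_add, hx, hy]
    | tmul n c =>
      have h := congrArg (fun t => (TensorProduct.rid k C t))
        (Coalgebra.lTensor_counit_comul (R := k) c)
      simp only [TensorProduct.rid_tmul, one_smul] at h
      trans n ⊗ₜ TensorProduct.rid k C ((counit (R := k)).lTensor C (comul (R := k) c))
      · simp only [LinearMap.comp_apply, LinearMap.lTensor_tmul, LinearEquiv.coe_coe]
        generalize comul (R := k) c = t
        induction t with
        | zero => simp
        | add x y hx hy => simp only [tmul_add, map_add, hx, hy]
        | tmul d e => simp
      · rw [h]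

variable (N) in
/-- The right `A`-module structure `(n ⊗ c) a = n a_ψ ⊗ c^ψ` on `N ⊗ C`. -/
@[reducible]
def tensorModule : Module Aᵐᵒᵖ (cofreeComodule k C N).carrier where
  smul a x := E.tensorAction N (x ⊗ₜ a.unop)
  one_smul x := E.tensorAction_one x
  mul_smul a b x := E.tensorAction_mul x b.unop a.unop
  smul_zero a := (congrArg _ (zero_tmul (R := k) (N ⊗[k] C) a.unop)).trans (map_zero _)
  smul_add a x y :=
    (congrArg _ (add_tmul (R := k) (M := N ⊗[k] C) x y a.unop)).trans (map_add _ _ _)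
  add_smul a b x :=
    (congrArg _ (tmul_add (R := k) (M := N ⊗[k] C) x a.unop b.unop)).trans (map_add _ _ _)
  zero_smul x := (congrArg _ (tmul_zero (R := k) (M := N ⊗[k] C) A x)).trans (map_zero _)

variable (N) in
theorem tensorModule_isScalarTower :
    letI := E.tensorModule N
    IsScalarTower k Aᵐᵒᵖ (cofreeComodule k C N).carrier := by
  let := E.tensorModule N
  exact ⟨fun r a x =>
    (congrArg _ (tmul_smul (R := k) (M := N ⊗[k] C) r x a.unop)).trans (map_smul _ _ _)⟩

/-- The axiom `map_comul` makes `N ⊗ C` an entwined module. The `A`-linear map `j` stands for the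
identification of `N ⊗ C` with a type carrying the action, so no module instance on the tensor
product itself is needed; `tensorObj` takes `j` to be the identity. -/
theorem tensorAction_comul (j : N ⊗[k] C →ₗ[k] N')
    (hj : ∀ x a, j (E.tensorAction N (x ⊗ₜ a)) = MulOpposite.op a • j x)
    (x : N ⊗[k] C) (a : A) :
    j.rTensor C ((TensorProduct.assoc k N C C).symm
      ((comul (R := k) (A := C)).lTensor N (E.tensorAction N (x ⊗ₜ a)))) =
    E.tensorAction N' (j.rTensor C ((TensorProduct.assoc k N C C).symm
      ((comul (R := k) (A := C)).lTensor N x)) ⊗ₜ a) := by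
  induction x with
  | zero => simp
  | add x y hx hy => simp only [add_tmul, map_add, hx, hy]
  | tmul n c =>
    rw [tensorAction_tmul, ← LinearMap.comp_apply (LinearMap.lTensor _ _),
      LinearMap.lTensor_comp_rTensor, ← LinearMap.rTensor_comp_lTensor, LinearMap.comp_apply,
      E.map_comul, LinearMap.lTensor_tmul]
    generalize comul (R := k) c = t
    induction t with
    | zero => simp
    | add x y hx hy => simp only [tmul_add, add_tmul, map_add, hx, hy]
    | tmul d e =>
      rw [TensorProduct.assoc_symm_tmul, LinearMap.rTensor_tmul, tensorAction_tmul]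
      simp only [TensorProduct.assoc_tmul, LinearMap.lTensor_tmul]
      generalize E.ψ (e ⊗ₜ a) = t
      induction t with
      | zero => simp
      | add x y hx hy => simp only [tmul_add, map_add, hx, hy]
      | tmul b e =>
        simp only [TensorProduct.assoc_symm_tmul, LinearMap.rTensor_tmul, orbit_apply]
        rw [← hj, tensorAction_tmul]
        generalize E.ψ (d ⊗ₜ b) = t
        induction t with
        | zero => simp
        | add x y hx hy => simp only [add_tmul, map_add, hx, hy]
        | tmul b e => simp

variable (N) in
/-- The entwined module `N ⊗ C` attached to a right `A`-module `N`. -/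
noncomputable def tensorObj : EntwinedModule E where
  toComodule := cofreeComodule k C N
  opModule := E.tensorModule N
  isScalarTower := E.tensorModule_isScalarTower N
  compat x a := by
    let := E.tensorModule N
    have := E.tensorModule_isScalarTower N
    let j : N ⊗[k] C →ₗ[k] (cofreeComodule k C N).carrier := LinearMap.id
    have hj : ∀ t, j.rTensor C t = t := LinearMap.congr_fun (LinearMap.rTensor_id C (N ⊗[k] C))
    have h := E.tensorAction_comul j (fun _ _ => rfl) x a
    rw [hj, hj] at h
    exact h

end Action

/-! ### Preliminaries on `N ⊗ C` and on pairing with `θ`. -/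

section Frobenius

variable {k : Type u} [CommRing k] {A : Type v} [Ring A] [Algebra k A]
  {C : Type v} [AddCommGroup C] [Module k C] [Coalgebra k C]
  (E : EntwiningStructure k A C) (θ : C ⊗[k] C →ₗ[k] A)

variable (N : Type v) [AddCommGroup N] [Module k N] [Module Aᵐᵒᵖ N] [IsScalarTower k Aᵐᵒᵖ N]

/-- The identification of `N ⊗ C` with the underlying module of `E.tensorObj N`. -/
noncomputable def tensorEquiv : N ⊗[k] C ≃ₗ[k] (E.tensorObj N).toComodule.carrier :=
  LinearEquiv.refl k (N ⊗[k] C)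

theorem op_smul_tensorEquiv (x : N ⊗[k] C) (a : A) :
    MulOpposite.op a • E.tensorEquiv N x = E.tensorEquiv N (E.tensorAction N (x ⊗ₜ a)) := rfl

theorem coact_tensorEquiv (x : N ⊗[k] C) :
    (E.tensorObj N).toComodule.coact (E.tensorEquiv N x) =
      (E.tensorEquiv N).toLinearMap.rTensor C ((TensorProduct.assoc k N C C).symm
        ((comul (R := k) (A := C)).lTensor N x)) := by
  have h : ∀ t, (LinearMap.id : N ⊗[k] C →ₗ[k] N ⊗[k] C).rTensor C t = t :=
    LinearMap.congr_fun (LinearMap.rTensor_id C (N ⊗[k] C))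
  exact (h _).symm

variable {N}

/-- `c ↦ a_ψ θ(c^ψ ⊗ d)` for `x = a ⊗ d`. -/
noncomputable def psiThetaRight (x : A ⊗[k] C) : C →ₗ[k] A :=
  E.psiTheta θ ∘ₗ (TensorProduct.mk k C (A ⊗[k] C)).flip x

theorem psiThetaRight_apply (x : A ⊗[k] C) (c : C) :
    E.psiThetaRight θ x c = E.psiTheta θ (c ⊗ₜ x) := rfl

theorem thetaAction_tensorAction (n : N) (d : C) (a : A) (c : C) :
    rightAction k A N (θ.lTensor N (TensorProduct.assoc k N C C
      (E.tensorAction N ((n ⊗ₜ d) ⊗ₜ a) ⊗ₜ c))) =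
    MulOpposite.op (E.psiTheta θ (d ⊗ₜ (a ⊗ₜ c))) • n := by
  rw [tensorAction_tmul]
  simp only [psiTheta, LinearMap.comp_apply, LinearEquiv.coe_coe, TensorProduct.assoc_symm_tmul,
    LinearMap.rTensor_tmul]
  generalize E.ψ (d ⊗ₜ a) = t
  induction t with
  | zero => simp
  | add x y hx hy => simp only [map_add, add_tmul, MulOpposite.op_add, add_smul, hx, hy]
  | tmul a' d' => simp [mul_smul]

end Frobenius

/-! ### The counit of the second adjunction, with `- ⊗ C` on the left of `F`. -/

section FrobeniusModule

variable {k : Type u} [CommRing k] {A : Type v} [Ring A] [Algebra k A]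
  {C : Type v} [AddCommGroup C] [Module k C] [Coalgebra k C]
  {E : EntwiningStructure k A C} (θ : C ⊗[k] C →ₗ[k] A) (M N : EntwinedModule E)

/-- The map `M ⊗ C → M`, `m ⊗ c ↦ m₀ θ(m₁ ⊗ c)`. -/
noncomputable def frobeniusCounit : M.toComodule.carrier ⊗[k] C →ₗ[k] M.toComodule.carrier :=
  rightAction k A M.toComodule.carrier ∘ₗ θ.lTensor M.toComodule.carrier ∘ₗ
    (TensorProduct.assoc k M.toComodule.carrier C C).toLinearMap ∘ₗ M.toComodule.coact.rTensor C

theorem frobeniusCounit_tmul (m : M.toComodule.carrier) (c : C) :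
    frobeniusCounit θ M (m ⊗ₜ c) = rightAction k A M.toComodule.carrier
      (θ.lTensor M.toComodule.carrier
        (TensorProduct.assoc k M.toComodule.carrier C C (M.toComodule.coact m ⊗ₜ c))) := rfl

variable {M N}

/-- Compatibility of action and coaction turns `(m a)₀ θ((m a)₁ ⊗ c)` into `m₀ a_ψ θ(m₁^ψ ⊗ c)`, so
that the Frobenius axioms written with `psiTheta` apply. -/
theorem frobeniusCounit_orbit (m : M.toComodule.carrier) (x : A ⊗[k] C) :
    frobeniusCounit θ M ((orbit k m).rTensor C x) = rightAction k A M.toComodule.carrier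
      ((E.psiThetaRight θ x).lTensor M.toComodule.carrier (M.toComodule.coact m)) := by
  induction x with
  | zero =>
    have h : E.psiThetaRight θ 0 = 0 := by ext; simp [psiThetaRight_apply]
    simp [h]
  | add x y hx hy =>
    have h : E.psiThetaRight θ (x + y) = E.psiThetaRight θ x + E.psiThetaRight θ y := by
      ext; simp [psiThetaRight_apply, tmul_add]
    rw [map_add, map_add, hx, hy, h, LinearMap.lTensor_add, LinearMap.add_apply, map_add]
  | tmul a c =>
    rw [LinearMap.rTensor_tmul, orbit_apply, frobeniusCounit_tmul, M.compat]
    generalize M.toComodule.coact m = t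
    induction t with
    | zero => simp
    | add x y hx hy => simp only [map_add, add_tmul, hx, hy]
    | tmul n d =>
      rw [thetaAction_tensorAction, LinearMap.lTensor_tmul, rightAction_tmul, psiThetaRight_apply]

variable {θ} {z : A ⊗[k] C}

theorem IsFrobeniusSystem.frobeniusCounit_tensorAction (h : E.IsFrobeniusSystem θ z)
    (x : M.toComodule.carrier ⊗[k] C) (a : A) :
    frobeniusCounit θ M (E.tensorAction _ (x ⊗ₜ a)) =
      MulOpposite.op a • frobeniusCounit θ M x := by
  induction x with
  | zero => simp
  | add x y hx hy => simp only [map_add, add_tmul, smul_add, hx, hy]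
  | tmul m c =>
    rw [tensorAction_tmul, frobeniusCounit_orbit, frobeniusCounit_tmul]
    generalize M.toComodule.coact m = t
    induction t with
    | zero => simp
    | add x y hx hy => simp only [map_add, add_tmul, smul_add, hx, hy]
    | tmul n d =>
      simp only [LinearMap.lTensor_tmul, rightAction_tmul, psiThetaRight_apply,
        TensorProduct.assoc_tmul]
      rw [← h.theta_mul, MulOpposite.op_mul, mul_smul]

/-- A triangle identity of the second adjunction: `normal_right` reduces the left side to `m₀
ε(m₁)`. -/
theorem IsFrobeniusSystem.frobeniusCounit_orbit_self (h : E.IsFrobeniusSystem θ z)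
    (m : M.toComodule.carrier) : frobeniusCounit θ M ((orbit k m).rTensor C z) = m := by
  rw [frobeniusCounit_orbit]
  conv_rhs => rw [← M.toComodule.counital m]
  generalize M.toComodule.coact m = t
  induction t with
  | zero => simp
  | add x y hx hy => simp only [map_add, hx, hy]
  | tmul n d =>
    rw [LinearMap.lTensor_tmul, LinearMap.lTensor_tmul, psiThetaRight_apply, h.normal_right,
      rightAction_tmul, TensorProduct.rid_tmul, Algebra.algebraMap_eq_smul_one,
      MulOpposite.op_smul, MulOpposite.op_one, smul_assoc, one_smul]

/-- Both sides meet in `m₀ θ(m₂ ⊗ c)_ψ ⊗ m₁^ψ`: the left by compatibility and coassociativity of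
`M`, the right by `theta_comul`. -/
theorem IsFrobeniusSystem.coact_frobeniusCounit (h : E.IsFrobeniusSystem θ z)
    (x : M.toComodule.carrier ⊗[k] C) :
    M.toComodule.coact (frobeniusCounit θ M x) =
      (frobeniusCounit θ M).rTensor C ((TensorProduct.assoc k M.toComodule.carrier C C).symm
        ((comul (R := k) (A := C)).lTensor M.toComodule.carrier x)) := by
  induction x with
  | zero => simp
  | add x y hx hy => simp only [map_add, hx, hy]
  | tmul m c =>
    let V := M.toComodule.carrier
    -- the map `(m ⊗ d) ⊗ e ↦ m θ(e ⊗ c)_ψ ⊗ d^ψ`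
    let Φ : (V ⊗[k] (C ⊗[k] C)) →ₗ[k] V ⊗[k] C :=
      (rightAction k A V).rTensor C ∘ₗ (TensorProduct.assoc k V A C).symm.toLinearMap ∘ₗ
        (E.ψ ∘ₗ (θ ∘ₗ (TensorProduct.mk k C C).flip c).lTensor C).lTensor V
    trans Φ ((comul (R := k) (A := C)).lTensor V (M.toComodule.coact m))
    · rw [← M.toComodule.coassoc m, frobeniusCounit_tmul]
      generalize M.toComodule.coact m = t
      induction t with
      | zero => simp
      | add x y hx hy => simp only [map_add, add_tmul, hx, hy]
      | tmul n d =>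
        simp only [TensorProduct.assoc_tmul, LinearMap.lTensor_tmul, rightAction_tmul,
          LinearMap.rTensor_tmul]
        rw [M.compat]
        generalize M.toComodule.coact n = t
        induction t with
        | zero => simp
        | add x y hx hy => simp only [map_add, add_tmul, hx, hy]
        | tmul n e =>
          simp only [tensorAction, Φ, LinearMap.comp_apply, LinearEquiv.coe_coe,
            TensorProduct.assoc_tmul, LinearMap.lTensor_tmul, LinearMap.flip_apply,
            TensorProduct.mk_apply]
          rfl
    · rw [LinearMap.lTensor_tmul]
      have hθ : ∀ d, E.ψ ((θ ∘ₗ (TensorProduct.mk k C C).flip c).lTensor C (comul (R := k) d)) =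
          θ.rTensor C ((TensorProduct.assoc k C C C).symm (d ⊗ₜ comul (R := k) c)) := by
        intro d
        rw [h.theta_comul]
        congr 1
        generalize comul (R := k) d = t
        induction t with
        | zero => simp
        | add x y hx hy => simp only [map_add, add_tmul, hx, hy]
        | tmul d e => simp
      trans (rightAction k A V).rTensor C ((TensorProduct.assoc k V A C).symm
        ((θ.rTensor C ∘ₗ (TensorProduct.assoc k C C C).symm.toLinearMap ∘ₗ
          (TensorProduct.mk k C (C ⊗[k] C)).flip (comul (R := k) c)).lTensor V
            (M.toComodule.coact m)))
      · generalize M.toComodule.coact m = t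
        induction t with
        | zero => simp
        | add x y hx hy => simp only [map_add, hx, hy]
        | tmul n d => simp [Φ, hθ]
      · generalize comul (R := k) c = s
        induction s with
        | zero => simp
        | add x y hx hy =>
          simp only [map_add, LinearMap.comp_add, LinearMap.lTensor_add, LinearMap.add_apply,
            hx, hy, tmul_add]
        | tmul c d =>
          rw [TensorProduct.assoc_symm_tmul, LinearMap.rTensor_tmul, frobeniusCounit_tmul]
          generalize M.toComodule.coact m = t
          induction t with
          | zero => simp
          | add x y hx hy => simp only [map_add, add_tmul, hx, hy]
          | tmul n e => simp

theorem frobeniusCounit_naturality (f : M ⟶ N) (x : M.toComodule.carrier ⊗[k] C) :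
    frobeniusCounit θ N (f.toComoduleHom.linear.rTensor C x) =
      f.toComoduleHom.linear (frobeniusCounit θ M x) := by
  induction x with
  | zero => simp
  | add x y hx hy => simp only [map_add, hx, hy]
  | tmul m c =>
    rw [LinearMap.rTensor_tmul, frobeniusCounit_tmul, frobeniusCounit_tmul,
      f.toComoduleHom.colinear]
    generalize M.toComodule.coact m = t
    induction t with
    | zero => simp
    | add x y hx hy => simp only [map_add, add_tmul, hx, hy]
    | tmul n d => simp [f.map_op_smul]

end FrobeniusModule

/-! ### The endomorphism of `N ⊗ C` given by `β`. -/

section Twist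

variable {k : Type u} [CommRing k] {A : Type v} [Ring A] [Algebra k A]
  {C : Type v} [AddCommGroup C] [Module k C] [Coalgebra k C]
  (E : EntwiningStructure k A C) (β : C →ₗ[k] A)
  {N : Type v} [AddCommGroup N] [Module k N] [Module Aᵐᵒᵖ N] [IsScalarTower k Aᵐᵒᵖ N]
  {N' : Type v} [AddCommGroup N'] [Module k N'] [Module Aᵐᵒᵖ N'] [IsScalarTower k Aᵐᵒᵖ N']

/-- The colinear map `C → A ⊗ C`, `c ↦ β(c₁) ⊗ c₂`. -/
noncomputable def coextend : C →ₗ[k] A ⊗[k] C := β.rTensor C ∘ₗ comul (R := k) (A := C)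

theorem coextend_apply (c : C) : coextend β c = β.rTensor C (comul (R := k) c) := rfl

variable (N) in
/-- The map `N ⊗ C → N ⊗ C`, `n ⊗ c ↦ n β(c₁) ⊗ c₂`. -/
noncomputable def twist : N ⊗[k] C →ₗ[k] N ⊗[k] C :=
  (rightAction k A N).rTensor C ∘ₗ (TensorProduct.assoc k N A C).symm.toLinearMap ∘ₗ
    (coextend β).lTensor N

theorem twist_tmul (n : N) (c : C) :
    twist β N (n ⊗ₜ c) = (orbit k n).rTensor C (coextend β c) := by
  simp only [twist, LinearMap.comp_apply, LinearEquiv.coe_coe, LinearMap.lTensor_tmul]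
  generalize coextend β c = t
  induction t with
  | zero => simp
  | add x y hx hy => simp only [tmul_add, map_add, hx, hy]
  | tmul a c => simp

theorem twist_naturality (h : N →ₗ[Aᵐᵒᵖ] N') (x : N ⊗[k] C) :
    twist β N' ((h.restrictScalars k).rTensor C x) =
      (h.restrictScalars k).rTensor C (twist β N x) := by
  induction x with
  | zero => simp
  | add x y hx hy => simp only [map_add, hx, hy]
  | tmul n c =>
    rw [LinearMap.rTensor_tmul, twist_tmul, twist_tmul, ← LinearMap.rTensor_comp_apply]
    congr 2
    ext a
    simp

theorem coextend_colinear (c : C) :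
    (TensorProduct.assoc k A C C).symm ((comul (R := k) (A := C)).lTensor A (coextend β c)) =
      (coextend β).rTensor C (comul (R := k) c) := by
  have h := congrArg (fun t => (TensorProduct.assoc k A C C).symm (β.rTensor _ t))
    (Coalgebra.coassoc_apply (R := k) c)
  rw [coextend_apply, ← LinearMap.comp_apply (LinearMap.lTensor _ _),
    LinearMap.lTensor_comp_rTensor, ← LinearMap.rTensor_comp_lTensor, LinearMap.comp_apply]
  refine h.symm.trans ?_
  generalize comul (R := k) c = t
  induction t with
  | zero => simp
  | add x y hx hy => simp only [map_add, hx, hy]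
  | tmul c d =>
    simp only [LinearMap.rTensor_tmul, coextend_apply]
    generalize comul (R := k) c = t
    induction t with
    | zero => simp
    | add x y hx hy => simp only [map_add, add_tmul, hx, hy]
    | tmul c e => simp

theorem twist_colinear (x : N ⊗[k] C) :
    (TensorProduct.assoc k N C C).symm
      ((comul (R := k) (A := C)).lTensor N (twist β N x)) =
    (twist β N).rTensor C ((TensorProduct.assoc k N C C).symm
      ((comul (R := k) (A := C)).lTensor N x)) := by
  induction x with
  | zero => simp
  | add x y hx hy => simp only [map_add, hx, hy]
  | tmul n c =>
    rw [twist_tmul, ← LinearMap.comp_apply (LinearMap.lTensor _ _),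
      LinearMap.lTensor_comp_rTensor, ← LinearMap.rTensor_comp_lTensor, LinearMap.comp_apply,
      LinearMap.lTensor_tmul]
    have h := (TensorProduct.assoc k A C C).symm_apply_eq.1 (coextend_colinear β c)
    rw [h]
    generalize comul (R := k) c = t
    induction t with
    | zero => simp
    | add x y hx hy => simp only [tmul_add, map_add, hx, hy]
    | tmul c d =>
      rw [TensorProduct.assoc_symm_tmul, LinearMap.rTensor_tmul, LinearMap.rTensor_tmul, twist_tmul]
      generalize coextend β c = t
      induction t with
      | zero => simp
      | add x y hx hy => simp only [map_add, add_tmul, hx, hy]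
      | tmul c e => simp

/-- `β(c) a = a_ψ β(c^ψ)` -/
def IsIntertwining : Prop :=
  ∀ (c : C) (a : A), β c * a = LinearMap.mul' k A (β.lTensor A (E.ψ (c ⊗ₜ[k] a)))

variable {E β}

/-- Both sides equal `a_ψ β((c^ψ)₁) ⊗ (c^ψ)₂`. On the left, `map_comul` splits `ψ` over the two legs
of `Δ(c)`, and the hypothesis absorbs the factor `β(c₁)` into the first leg. -/
theorem IsIntertwining.tensorAction_coextend (h : E.IsIntertwining β) (c : C) (a : A) :
    E.tensorAction A (coextend β c ⊗ₜ a) = twist β A (E.ψ (c ⊗ₜ a)) := by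
  trans (LinearMap.mul' k A ∘ₗ β.lTensor A).rTensor C ((TensorProduct.assoc k A C C).symm
    ((comul (R := k) (A := C)).lTensor A (E.ψ (c ⊗ₜ a))))
  · rw [E.map_comul, LinearEquiv.symm_apply_apply, coextend_apply]
    generalize comul (R := k) c = t
    induction t with
    | zero => simp
    | add x y hx hy => simp only [map_add, add_tmul, hx, hy]
    | tmul c d =>
      rw [LinearMap.rTensor_tmul, tensorAction_tmul]
      simp only [TensorProduct.assoc_tmul, LinearMap.lTensor_tmul]
      generalize E.ψ (d ⊗ₜ a) = t
      induction t with
      | zero => simp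
      | add x y hx hy => simp only [map_add, tmul_add, hx, hy]
      | tmul b d => simp [h c b]
  · generalize E.ψ (c ⊗ₜ a) = t
    induction t with
    | zero => simp
    | add x y hx hy => simp only [map_add, hx, hy]
    | tmul b d =>
      rw [twist_tmul, coextend_apply, LinearMap.lTensor_tmul]
      generalize comul (R := k) d = t
      induction t with
      | zero => simp
      | add x y hx hy => simp only [map_add, tmul_add, hx, hy]
      | tmul c d => simp

theorem IsIntertwining.twist_tensorAction (h : E.IsIntertwining β) (x : N ⊗[k] C) (a : A) :
    twist β N (E.tensorAction N (x ⊗ₜ a)) = E.tensorAction N (twist β N x ⊗ₜ a) := by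
  induction x with
  | zero => simp
  | add x y hx hy => simp only [map_add, add_tmul, hx, hy]
  | tmul n c =>
    rw [tensorAction_tmul, twist_tmul]
    refine (twist_naturality β (orbitMap n) _).trans ?_
    rw [← h.tensorAction_coextend]
    exact E.rTensor_tensorAction (orbitMap n) _ a

end Twist

/-! ### Condition `(*)` as a normalization of `β` against `θ`. -/

section Normalization

variable {k : Type u} [CommRing k] {A : Type v} [Ring A] [Algebra k A]
  {C : Type v} [AddCommGroup C] [Module k C] [Coalgebra k C]
  (E : EntwiningStructure k A C) (θ : C ⊗[k] C →ₗ[k] A) (β : C →ₗ[k] A)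

/-- The map `c ↦ β(c₂)_ψ θ(c₁^ψ ⊗ c₃)`. -/
noncomputable def normalizer : C →ₗ[k] A :=
  E.psiTheta θ ∘ₗ (coextend β).lTensor C ∘ₗ comul (R := k) (A := C)

theorem normalizer_apply (c : C) :
    E.normalizer θ β c = E.psiTheta θ ((coextend β).lTensor C (comul (R := k) c)) := rfl

/-- Since `ψ` is multiplicative, `ψ₂` and `ψ₃`, which both move `c₁`, combine into one `ψ` applied
to `c₁` and the product `β(c₃)_{ψ₁} θ(c₂^{ψ₁} ⊗ c₄)`. -/
theorem separabilityMap_apply (c : C) :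
    E.separabilityMap θ β c = E.ψ ((E.normalizer θ β).lTensor C (comul (R := k) c)) := by
  let W : C ⊗[k] (C ⊗[k] (A ⊗[k] C)) →ₗ[k] A ⊗[k] C :=
    (LinearMap.mul' k A).rTensor C ∘ₗ (TensorProduct.assoc k A A C).symm.toLinearMap ∘ₗ
    E.ψ.lTensor A ∘ₗ (θ.lTensor C).lTensor A ∘ₗ
    (TensorProduct.assoc k A C (C ⊗[k] C)).toLinearMap ∘ₗ E.ψ.rTensor (C ⊗[k] C) ∘ₗ
    (TensorProduct.assoc k C A (C ⊗[k] C)).symm.toLinearMap ∘ₗ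
    ((TensorProduct.assoc k A C C).toLinearMap ∘ₗ E.ψ.rTensor C ∘ₗ
      (TensorProduct.assoc k C A C).symm.toLinearMap).lTensor C
  -- `W` is everything in `separabilityMap` after `β` is applied, so this identity does not involve
  -- `β`.
  have hW : W = E.ψ ∘ₗ (E.psiTheta θ).lTensor C := by
    refine TensorProduct.ext' fun c t => ?_
    induction t with
    | zero => simp
    | add x y hx hy => simp only [map_add, tmul_add, hx, hy]
    | tmul d t =>
      induction t with
      | zero => simp
      | add x y hx hy => simp only [map_add, tmul_add, hx, hy]
      | tmul a e =>
        simp only [W, psiTheta, LinearMap.comp_apply, LinearEquiv.coe_coe, LinearMap.lTensor_tmul,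
          TensorProduct.assoc_symm_tmul, LinearMap.rTensor_tmul]
        generalize E.ψ (d ⊗ₜ a) = t
        induction t with
        | zero => simp
        | add x y hx hy => simp only [map_add, add_tmul, tmul_add, hx, hy]
        | tmul a d =>
          simp only [LinearMap.lTensor_tmul, TensorProduct.assoc_symm_tmul,
            TensorProduct.assoc_tmul, LinearMap.rTensor_tmul, LinearMap.mul'_apply]
          rw [E.map_mul]
          generalize E.ψ (c ⊗ₜ a) = t
          induction t with
          | zero => simp
          | add x y hx hy => simp only [map_add, add_tmul, hx, hy]
          | tmul a c => simp
  have hsep : E.separabilityMap θ β = W ∘ₗ ((β.rTensor C).lTensor C).lTensor C ∘ₗ comul₄ k C := rfl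
  rw [hsep, hW, comul₄]
  simp only [LinearMap.comp_apply]
  congr 1
  generalize comul (R := k) c = t
  induction t with
  | zero => simp
  | add x y hx hy => simp only [map_add, hx, hy]
  | tmul c d =>
    simp only [LinearMap.lTensor_tmul, normalizer_apply]
    generalize comul (R := k) d = t
    induction t with
    | zero => simp
    | add x y hx hy => simp only [map_add, tmul_add, hx, hy]
    | tmul d e => simp [coextend_apply]

variable {θ β}

/-- Apply `A ⊗ ε` to `ψ(c₁ ⊗ ν(c₂)) = 1 ⊗ c`, where `ν` is the normalizer. By `map_counit` the left
side becomes `ε(c₁) ν(c₂) = ν(c)`. -/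
theorem normalizer_eq_algebraMap (h : ∀ c, E.separabilityMap θ β c = 1 ⊗ₜ[k] c) (c : C) :
    E.normalizer θ β c = algebraMap k A (counit (R := k) c) := by
  have key : ∀ t : C ⊗[k] A, TensorProduct.rid k A ((counit (R := k) (A := C)).lTensor A (E.ψ t)) =
      TensorProduct.lid k A ((counit (R := k) (A := C)).rTensor A t) := by
    intro t
    induction t with
    | zero => simp
    | add x y hx hy => simp only [map_add, hx, hy]
    | tmul c a => simp [E.map_counit]
  have hc := h c
  rw [separabilityMap_apply] at hc
  have h1 := key ((E.normalizer θ β).lTensor C (comul (R := k) c))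
  rw [hc, ← LinearMap.comp_apply (LinearMap.rTensor _ _), LinearMap.rTensor_comp_lTensor,
    ← LinearMap.lTensor_comp_rTensor, LinearMap.comp_apply,
    Coalgebra.rTensor_counit_comul] at h1
  simpa [Algebra.algebraMap_eq_smul_one] using h1.symm

end Normalization

/-! ### Splittings of the coactions and their description by `β`. -/

section Splitting

variable {k : Type u} [CommRing k] {A : Type v} [Ring A] [Algebra k A]
  {C : Type v} [AddCommGroup C] [Module k C] [Coalgebra k C]
  {E : EntwiningStructure k A C} {θ : C ⊗[k] C →ₗ[k] A} {z : A ⊗[k] C} {β : C →ₗ[k] A}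

/-- The composite is `m₀ β(m₂)_ψ θ(m₁^ψ ⊗ m₃)`; coassociativity of `M` gathers `m₁`, `m₂`, `m₃` into
a single element of `C`, to which the normalizer applies. -/
theorem frobeniusCounit_twist_coact (M : EntwinedModule E) (m : M.toComodule.carrier) :
    frobeniusCounit θ M (twist β _ (M.toComodule.coact m)) =
      rightAction k A M.toComodule.carrier
        ((E.normalizer θ β).lTensor M.toComodule.carrier (M.toComodule.coact m)) := by
  let Φ : M.toComodule.carrier ⊗[k] (C ⊗[k] C) →ₗ[k] M.toComodule.carrier :=
    rightAction k A M.toComodule.carrier ∘ₗ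
      (E.psiTheta θ ∘ₗ (coextend β).lTensor C).lTensor M.toComodule.carrier
  trans Φ (TensorProduct.assoc k _ C C (M.toComodule.coact.rTensor C (M.toComodule.coact m)))
  · generalize M.toComodule.coact m = t
    induction t with
    | zero => simp
    | add x y hx hy => simp only [map_add, hx, hy]
    | tmul n c =>
      rw [twist_tmul, frobeniusCounit_orbit, LinearMap.rTensor_tmul]
      generalize M.toComodule.coact n = t
      induction t with
      | zero => simp
      | add x y hx hy => simp only [map_add, add_tmul, hx, hy]
      | tmul n d => simp [Φ, psiThetaRight_apply]
  · rw [M.toComodule.coassoc]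
    generalize M.toComodule.coact m = t
    induction t with
    | zero => simp
    | add x y hx hy => simp only [map_add, hx, hy]
    | tmul n c => simp [Φ, normalizer_apply]

theorem frobeniusCounit_twist_coact_eq_self
    (h : ∀ c, E.separabilityMap θ β c = 1 ⊗ₜ[k] c)
    (M : EntwinedModule E) (m : M.toComodule.carrier) :
    frobeniusCounit θ M (twist β _ (M.toComodule.coact m)) = m := by
  rw [frobeniusCounit_twist_coact]
  conv_rhs => rw [← M.toComodule.counital m]
  generalize M.toComodule.coact m = t
  induction t with
  | zero => simp
  | add x y hx hy => simp only [map_add, hx, hy]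
  | tmul n c =>
    rw [LinearMap.lTensor_tmul, LinearMap.lTensor_tmul, normalizer_eq_algebraMap E h,
      rightAction_tmul, TensorProduct.rid_tmul, Algebra.algebraMap_eq_smul_one,
      MulOpposite.op_smul, MulOpposite.op_one, smul_assoc, one_smul]

variable (E) in
/-- A natural family of colinear maps `M ⊗ C → M`, for entwined modules `M`, that splits the
coactions. -/
structure CoactionSplitting where
  /-- The map `M ⊗ C → M`. -/
  map : ∀ M : EntwinedModule E, M.toComodule.carrier ⊗[k] C →ₗ[k] M.toComodule.carrier
  naturality : ∀ {M N : EntwinedModule E} (f : M ⟶ N) (x : M.toComodule.carrier ⊗[k] C),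
    map N (f.toComoduleHom.linear.rTensor C x) = f.toComoduleHom.linear (map M x)
  colinear : ∀ (M : EntwinedModule E) (x : M.toComodule.carrier ⊗[k] C),
    M.toComodule.coact (map M x) =
      (map M).rTensor C ((TensorProduct.assoc k M.toComodule.carrier C C).symm
        ((comul (R := k) (A := C)).lTensor M.toComodule.carrier x))
  map_coact : ∀ (M : EntwinedModule E) (m : M.toComodule.carrier),
    map M (M.toComodule.coact m) = m

/-- The maps `m ⊗ c ↦ m₀ β(c₁)_ψ θ(m₁^ψ ⊗ c₂)`. -/
noncomputable def IsFrobeniusSystem.splitting (hθz : E.IsFrobeniusSystem θ z)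
    (h : ∀ c, E.separabilityMap θ β c = 1 ⊗ₜ[k] c) : CoactionSplitting E where
  map M := frobeniusCounit θ M ∘ₗ twist β M.toComodule.carrier
  naturality {M N} f x := by
    let f' : M.toComodule.carrier →ₗ[Aᵐᵒᵖ] N.toComodule.carrier :=
      { toFun := f.toComoduleHom.linear
        map_add' := map_add _
        map_smul' := f.map_op_smul }
    refine (congrArg (frobeniusCounit θ N) (twist_naturality β f' x)).trans ?_
    exact frobeniusCounit_naturality f _
  colinear M x := by
    rw [LinearMap.comp_apply, hθz.coact_frobeniusCounit, twist_colinear,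
      LinearMap.rTensor_comp_apply]
  map_coact M m := frobeniusCounit_twist_coact_eq_self h M m

theorem IsFrobeniusSystem.splitting_map (hθz : E.IsFrobeniusSystem θ z)
    (h : ∀ c, E.separabilityMap θ β c = 1 ⊗ₜ[k] c) (M : EntwinedModule E) :
    (hθz.splitting h).map M = frobeniusCounit θ M ∘ₗ twist β M.toComodule.carrier := rfl

/-- The splitting is `A`-linear. -/
def CoactionSplitting.IsLinear (S : CoactionSplitting E) : Prop :=
  ∀ (M : EntwinedModule E) (x : M.toComodule.carrier ⊗[k] C) (a : A),
    S.map M (E.tensorAction _ (x ⊗ₜ a)) = MulOpposite.op a • S.map M x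

theorem IsFrobeniusSystem.splitting_isLinear (hθz : E.IsFrobeniusSystem θ z)
    (h : ∀ c, E.separabilityMap θ β c = 1 ⊗ₜ[k] c) (hβ : E.IsIntertwining β) :
    (hθz.splitting h).IsLinear := fun M x a => by
  rw [hθz.splitting_map, LinearMap.comp_apply, hβ.twist_tensorAction,
    hθz.frobeniusCounit_tensorAction, LinearMap.comp_apply]

/-! ### Morphisms of entwined modules -/

/-- The morphism `A ⊗ C → M`, `a ⊗ c ↦ (m a)₀ θ((m a)₁ ⊗ c)`, attached to `m : M`. -/
noncomputable def IsFrobeniusSystem.elementHom (hθz : E.IsFrobeniusSystem θ z)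
    (M : EntwinedModule E) (m : M.toComodule.carrier) : E.tensorObj A ⟶ M where
  toComoduleHom :=
    { linear := frobeniusCounit θ M ∘ₗ (orbit k m).rTensor C ∘ₗ
        (E.tensorEquiv A).symm.toLinearMap
      colinear := fun x => by
        obtain ⟨x, rfl⟩ := (E.tensorEquiv A).surjective x
        rw [coact_tensorEquiv, LinearMap.comp_apply, hθz.coact_frobeniusCounit,
          ← LinearMap.rTensor_comp_apply]
        simp only [LinearMap.comp_apply, LinearEquiv.coe_coe, LinearEquiv.symm_apply_apply]
        induction x with
        | zero => simp
        | add x y hx hy => simp only [map_add, hx, hy]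
        | tmul a c =>
          simp only [LinearMap.rTensor_tmul, LinearMap.lTensor_tmul]
          generalize comul (R := k) c = t
          induction t with
          | zero => simp
          | add x y hx hy => simp only [map_add, tmul_add, hx, hy]
          | tmul c d => simp }
  map_op_smul a x := by
    obtain ⟨x, rfl⟩ := (E.tensorEquiv A).surjective x
    have h := E.op_smul_tensorEquiv A x a.unop
    rw [MulOpposite.op_unop] at h
    rw [h]
    simp only [LinearMap.comp_apply, LinearEquiv.coe_coe, LinearEquiv.symm_apply_apply]
    refine (congrArg _ (E.rTensor_tensorAction (orbitMap m) x a.unop)).trans ?_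
    exact hθz.frobeniusCounit_tensorAction _ a.unop

theorem IsFrobeniusSystem.elementHom_linear (hθz : E.IsFrobeniusSystem θ z)
    (M : EntwinedModule E) (m : M.toComodule.carrier) (x : A ⊗[k] C) :
    (hθz.elementHom M m).toComoduleHom.linear (E.tensorEquiv A x) =
      frobeniusCounit θ M ((orbit k m).rTensor C x) := rfl

variable (E) in
/-- Left multiplication by `a : A` on `A ⊗ C`. -/
noncomputable def mulLeftHom (a : A) : E.tensorObj A ⟶ E.tensorObj A where
  toComoduleHom :=
    { linear := (E.tensorEquiv A).toLinearMap ∘ₗ (LinearMap.mulLeft k a).rTensor C ∘ₗ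
        (E.tensorEquiv A).symm.toLinearMap
      colinear := fun x => by
        obtain ⟨x, rfl⟩ := (E.tensorEquiv A).surjective x
        simp only [LinearMap.comp_apply, LinearEquiv.coe_coe, LinearEquiv.symm_apply_apply]
        rw [coact_tensorEquiv, coact_tensorEquiv, ← LinearMap.rTensor_comp_apply]
        induction x with
        | zero => simp
        | add x y hx hy => simp only [map_add, hx, hy]
        | tmul b c =>
          simp only [LinearMap.rTensor_tmul, LinearMap.lTensor_tmul]
          generalize comul (R := k) c = t
          induction t with
          | zero => simp
          | add x y hx hy => simp only [map_add, tmul_add, hx, hy]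
          | tmul c d => simp }
  map_op_smul b x := by
    obtain ⟨x, rfl⟩ := (E.tensorEquiv A).surjective x
    have h := E.op_smul_tensorEquiv A x b.unop
    have h' := E.op_smul_tensorEquiv A ((LinearMap.mulLeft k a).rTensor C x) b.unop
    rw [MulOpposite.op_unop] at h h'
    rw [h]
    simp only [LinearMap.comp_apply, LinearEquiv.coe_coe, LinearEquiv.symm_apply_apply]
    rw [h']
    congr 1
    let l : A →ₗ[Aᵐᵒᵖ] A :=
      { toFun := fun b => a * b
        map_add' := mul_add a
        map_smul' := fun r b => (mul_assoc a b r.unop).symm }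
    exact E.rTensor_tensorAction l x b.unop

theorem mulLeftHom_linear (a : A) (x : A ⊗[k] C) :
    (E.mulLeftHom a).toComoduleHom.linear (E.tensorEquiv A x) =
      E.tensorEquiv A ((LinearMap.mulLeft k a).rTensor C x) := rfl

/-! ### The map `β` of a splitting -/

namespace CoactionSplitting

variable (S : CoactionSplitting E) (z)

/-- The map `c ↦ S(z ⊗ c)` from `C` to `A ⊗ C`. -/
noncomputable def sectionMap : C →ₗ[k] A ⊗[k] C :=
  (E.tensorEquiv A).symm.toLinearMap ∘ₗ S.map (E.tensorObj A) ∘ₗ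
    TensorProduct.mk k _ C (E.tensorEquiv A z)

/-- The composite of `c ↦ S(z ⊗ c)` with `A ⊗ ε`. -/
noncomputable def beta : C →ₗ[k] A :=
  (TensorProduct.rid k A).toLinearMap ∘ₗ (counit (R := k) (A := C)).lTensor A ∘ₗ S.sectionMap z

theorem tensorEquiv_sectionMap (c : C) :
    E.tensorEquiv A (S.sectionMap z c) = S.map (E.tensorObj A) (E.tensorEquiv A z ⊗ₜ c) := by
  simp [sectionMap]

/-- The cofree comodule `A ⊗ C` has the universal property that a colinear map into it is recovered
from its composite with `A ⊗ ε`. Here colinearity of the section comes from that of `S`. -/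
theorem sectionMap_eq_coextend : S.sectionMap z = coextend (S.beta z) := by
  ext c
  have h := S.colinear (E.tensorObj A) (E.tensorEquiv A z ⊗ₜ c)
  rw [← tensorEquiv_sectionMap, coact_tensorEquiv] at h
  have h2 := congrArg ((E.tensorEquiv A).symm.toLinearMap.rTensor C) h
  rw [← LinearMap.rTensor_comp_apply, ← LinearMap.rTensor_comp_apply] at h2
  have h3 : (E.tensorEquiv A).symm.toLinearMap ∘ₗ (E.tensorEquiv A).toLinearMap =
    LinearMap.id := by ext; simp
  rw [h3, LinearMap.rTensor_id, LinearMap.id_apply, LinearMap.lTensor_tmul] at h2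
  have h4 : ((E.tensorEquiv A).symm.toLinearMap ∘ₗ S.map (E.tensorObj A)).rTensor C
      ((TensorProduct.assoc k _ C C).symm (E.tensorEquiv A z ⊗ₜ comul (R := k) c)) =
      (S.sectionMap z).rTensor C (comul (R := k) c) := by
    generalize comul (R := k) c = t
    induction t with
    | zero => simp
    | add x y hx hy => simp only [map_add, tmul_add, hx, hy]
    | tmul c d => simp [sectionMap]
  rw [h4] at h2
  -- Applying `A ⊗ ε ⊗ C` gives `coextend (S.beta z) c` on the right, and on the left counitality of
  -- `C` returns the section itself.
  have h5 := congrArg (((TensorProduct.rid k A).toLinearMap ∘ₗ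
    (counit (R := k) (A := C)).lTensor A).rTensor C) h2
  rw [← LinearMap.rTensor_comp_apply] at h5
  refine Eq.trans ?_ h5
  generalize S.sectionMap z c = t
  induction t with
  | zero => simp
  | add x y hx hy => simp only [map_add, ← hx, ← hy]
  | tmul a d =>
    have h6 := congrArg (fun t => a ⊗ₜ[k] TensorProduct.lid k C t)
      (Coalgebra.rTensor_counit_comul (R := k) d)
    simp only [TensorProduct.lid_tmul, one_smul] at h6
    refine h6.symm.trans ?_
    rw [LinearMap.lTensor_tmul]
    generalize comul (R := k) d = t
    induction t with
    | zero => simp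
    | add x y hx hy => simp only [map_add, tmul_add, hx, hy]
    | tmul c d => simp [smul_tmul]

variable {z}

/-- A Yoneda argument: `elementHom M m` sends `z` to `m`, so naturality determines `S(m ⊗ c)` from
`S(z ⊗ c)`. -/
theorem map_eq (hθz : E.IsFrobeniusSystem θ z) (M : EntwinedModule E) :
    S.map M = frobeniusCounit θ M ∘ₗ twist (S.beta z) M.toComodule.carrier := by
  refine TensorProduct.ext' fun m c => ?_
  have h := S.naturality (hθz.elementHom M m) (E.tensorEquiv A z ⊗ₜ c)
  rw [← tensorEquiv_sectionMap, LinearMap.rTensor_tmul, hθz.elementHom_linear,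
    hθz.elementHom_linear, hθz.frobeniusCounit_orbit_self, sectionMap_eq_coextend] at h
  rw [h, LinearMap.comp_apply, twist_tmul]

/-- The splitting identity for `A ⊗ C` at `1 ⊗ c`: the coaction gives `(1 ⊗ c₁) ⊗ c₂`, and acting on
`1 ⊗ c₁` by the normalizer of `c₂` produces `ψ(c₁ ⊗ ν(c₂))`. -/
theorem separabilityMap_beta (hθz : E.IsFrobeniusSystem θ z) (c : C) :
    E.separabilityMap θ (S.beta z) c = 1 ⊗ₜ[k] c := by
  apply (E.tensorEquiv A).injective
  rw [← S.map_coact (E.tensorObj A) (E.tensorEquiv A (1 ⊗ₜ c)), S.map_eq hθz,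
    LinearMap.comp_apply, frobeniusCounit_twist_coact, coact_tensorEquiv, separabilityMap_apply,
    LinearMap.lTensor_tmul]
  generalize comul (R := k) c = t
  induction t with
  | zero => simp
  | add x y hx hy => simp only [map_add, tmul_add, hx, hy]
  | tmul c d =>
    rw [TensorProduct.assoc_symm_tmul, LinearMap.rTensor_tmul, LinearMap.lTensor_tmul,
      LinearMap.lTensor_tmul, rightAction_tmul, LinearEquiv.coe_coe, op_smul_tensorEquiv,
      tensorAction_tmul]
    have h : orbit k (1 : A) = LinearMap.id := by ext; simp
    rw [h, LinearMap.rTensor_id, LinearMap.id_apply]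

/-- Linearity of `S` at `z ⊗ c` gives `S(z a_ψ ⊗ c^ψ) = S(z ⊗ c) a`. Centrality of `z` lets `a_ψ`
come out on the left, and `A ⊗ ε` then yields the identity for `β`. -/
theorem isIntertwining_beta (hθz : E.IsFrobeniusSystem θ z) (hS : S.IsLinear) :
    E.IsIntertwining (S.beta z) := fun c a => by
  have h := hS (E.tensorObj A) (E.tensorEquiv A z ⊗ₜ c) a
  rw [← tensorEquiv_sectionMap, op_smul_tensorEquiv, tensorAction_tmul] at h
  -- `S(z b ⊗ d) = S(b z ⊗ d) = b S(z ⊗ d)`: centrality of `z`, then naturality of `S` for left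
  -- multiplication by `b`.
  have h1 : ∀ t : A ⊗[k] C, S.map (E.tensorObj A) ((orbit k (E.tensorEquiv A z)).rTensor C t) =
      E.tensorEquiv A ((LinearMap.mul' k A).rTensor C ((TensorProduct.assoc k A A C).symm
        ((S.sectionMap z).lTensor A t))) := by
    intro t
    induction t with
    | zero => simp
    | add x y hx hy => simp only [map_add, hx, hy]
    | tmul b d =>
      have hz : E.tensorAction A (z ⊗ₜ b) = (LinearMap.mulLeft k b).rTensor C z := by
        have hm : LinearMap.mul' k A = rightAction k A A := by
          ext
          simp
        rw [hθz.central, tensorAction, hm]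
        rfl
      rw [LinearMap.rTensor_tmul, orbit_apply, op_smul_tensorEquiv, hz, ← mulLeftHom_linear,
        ← LinearMap.rTensor_tmul, S.naturality, ← tensorEquiv_sectionMap, mulLeftHom_linear,
        LinearMap.lTensor_tmul]
      congr 1
      generalize S.sectionMap z d = t
      induction t with
      | zero => simp
      | add x y hx hy => simp only [map_add, tmul_add, hx, hy]
      | tmul c d => simp
  rw [h1] at h
  have h2 := congrArg (fun t => TensorProduct.rid k A ((counit (R := k) (A := C)).lTensor A t))
    ((E.tensorEquiv A).injective h)
  -- `A ⊗ ε` is right `A`-linear, by `map_counit`.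
  have hl : ∀ t : A ⊗[k] C, TensorProduct.rid k A ((counit (R := k) (A := C)).lTensor A
      (E.tensorAction A (t ⊗ₜ a))) =
      TensorProduct.rid k A ((counit (R := k) (A := C)).lTensor A t) * a := by
    intro t
    induction t with
    | zero => simp
    | add x y hx hy => simp only [map_add, add_tmul, add_mul, hx, hy]
    | tmul b d =>
      have := E.map_counit d a
      rw [tensorAction_tmul]
      trans b * TensorProduct.rid k A ((counit (R := k) (A := C)).lTensor A (E.ψ (d ⊗ₜ a)))
      · generalize E.ψ (d ⊗ₜ a) = t
        induction t with
        | zero => simp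
        | add x y hx hy => simp only [map_add, mul_add, hx, hy]
        | tmul b d => simp
      · rw [this]
        simp
  have hr : ∀ t : A ⊗[k] C, TensorProduct.rid k A ((counit (R := k) (A := C)).lTensor A
      ((LinearMap.mul' k A).rTensor C ((TensorProduct.assoc k A A C).symm
        ((S.sectionMap z).lTensor A t)))) =
      LinearMap.mul' k A ((S.beta z).lTensor A t) := by
    intro t
    induction t with
    | zero => simp
    | add x y hx hy => simp only [map_add, hx, hy]
    | tmul b d =>
      simp only [LinearMap.lTensor_tmul, LinearMap.mul'_apply, beta, LinearMap.comp_apply,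
        LinearEquiv.coe_coe]
      generalize S.sectionMap z d = t
      induction t with
      | zero => simp
      | add x y hx hy => simp only [map_add, tmul_add, mul_add, hx, hy]
      | tmul c d => simp
  simp only [hl, hr] at h2
  exact h2.symm

end CoactionSplitting

end Splitting

/-! ### Separability of `F` in terms of splittings of the coactions. -/

section Rafael

variable {k : Type u} [CommRing k] {A : Type v} [Ring A] [Algebra k A]
  {C : Type v} [AddCommGroup C] [Module k C] [Coalgebra k C]
  {E : EntwiningStructure k A C}

/-- The functorial action of `- ⊗ C` on an `A`-linear map between entwined modules. -/
noncomputable def tensorMap {M N : EntwinedModule E}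
    (h : M.toComodule.carrier →ₗ[Aᵐᵒᵖ] N.toComodule.carrier) :
    E.tensorObj M.toComodule.carrier ⟶ E.tensorObj N.toComodule.carrier where
  toComoduleHom :=
    { linear := (E.tensorEquiv _).toLinearMap ∘ₗ (h.restrictScalars k).rTensor C ∘ₗ
        (E.tensorEquiv _).symm.toLinearMap
      colinear := fun x => by
        obtain ⟨x, rfl⟩ := (E.tensorEquiv _).surjective x
        simp only [LinearMap.comp_apply, LinearEquiv.coe_coe, LinearEquiv.symm_apply_apply]
        rw [coact_tensorEquiv, coact_tensorEquiv, ← LinearMap.rTensor_comp_apply]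
        induction x with
        | zero => simp
        | add x y hx hy => simp only [map_add, hx, hy]
        | tmul b c =>
          simp only [LinearMap.rTensor_tmul, LinearMap.lTensor_tmul]
          generalize comul (R := k) c = t
          induction t with
          | zero => simp
          | add x y hx hy => simp only [map_add, tmul_add, hx, hy]
          | tmul c d => simp }
  map_op_smul b x := by
    obtain ⟨x, rfl⟩ := (E.tensorEquiv _).surjective x
    have h₁ := E.op_smul_tensorEquiv _ x b.unop
    have h₂ := E.op_smul_tensorEquiv _ ((h.restrictScalars k).rTensor C x) b.unop
    rw [MulOpposite.op_unop] at h₁ h₂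
    rw [h₁]
    simp only [LinearMap.comp_apply, LinearEquiv.coe_coe, LinearEquiv.symm_apply_apply]
    rw [h₂, E.rTensor_tensorAction]

/-- The coaction as a morphism of entwined modules `M ⟶ M ⊗ C`. -/
noncomputable def coactHom (M : EntwinedModule E) : M ⟶ E.tensorObj M.toComodule.carrier where
  toComoduleHom :=
    { linear := (E.tensorEquiv _).toLinearMap ∘ₗ M.toComodule.coact
      colinear := fun m => by
        rw [LinearMap.comp_apply, LinearEquiv.coe_coe, coact_tensorEquiv, ← M.toComodule.coassoc,
          LinearEquiv.symm_apply_apply, ← LinearMap.rTensor_comp_apply] }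
  map_op_smul a m := by
    have h := E.op_smul_tensorEquiv _ (M.toComodule.coact m) a.unop
    have h' := M.compat m a.unop
    rw [MulOpposite.op_unop] at h h'
    simp only [LinearMap.comp_apply, LinearEquiv.coe_coe]
    rw [h, h']

/-- The `A`-linear map `m ⊗ c ↦ ε(c) m`, from the module underlying `M ⊗ C` to `M`. -/
noncomputable def tensorCounit (M : EntwinedModule E) :
    (E.tensorObj M.toComodule.carrier).toComodule.carrier →ₗ[Aᵐᵒᵖ] M.toComodule.carrier where
  toFun x := TensorProduct.rid k _ ((counit (R := k) (A := C)).lTensor _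
    ((E.tensorEquiv _).symm x))
  map_add' x y := by simp only [map_add]
  map_smul' a x := by
    obtain ⟨x, rfl⟩ := (E.tensorEquiv _).surjective x
    have h := E.op_smul_tensorEquiv _ x a.unop
    rw [MulOpposite.op_unop] at h
    rw [h, LinearEquiv.symm_apply_apply, LinearEquiv.symm_apply_apply, RingHom.id_apply]
    clear h
    induction x with
    | zero => simp
    | add x y hx hy => simp only [map_add, add_tmul, smul_add, hx, hy]
    | tmul m c =>
      have h := congrArg (orbit k m) (E.map_counit c a.unop)
      rw [tensorAction_tmul]
      trans orbit k m (TensorProduct.rid k A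
        ((counit (R := k) (A := C)).lTensor A (E.ψ (c ⊗ₜ a.unop))))
      · generalize E.ψ (c ⊗ₜ a.unop) = t
        induction t with
        | zero => simp
        | add x y hx hy => simp only [map_add, hx, hy]
        | tmul b d => simp
      · rw [h, map_smul, orbit_apply, MulOpposite.op_unop, LinearMap.lTensor_tmul,
          TensorProduct.rid_tmul, smul_comm]

/-- `tensorCounit` as a morphism of `A`-modules. -/
noncomputable def counitHom (M : EntwinedModule E) :
    E.forgetToModule.obj (E.tensorObj M.toComodule.carrier) ⟶ E.forgetToModule.obj M :=
  ModuleCat.ofHom (tensorCounit M)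

theorem counitHom_naturality {M N : EntwinedModule E} (f : M ⟶ N) :
    E.forgetToModule.map (tensorMap (E.forgetToModule.map f).hom) ≫
        counitHom N =
      counitHom M ≫ E.forgetToModule.map f := by
  ext x
  obtain ⟨x, rfl⟩ := (E.tensorEquiv _).surjective x
  change TensorProduct.rid k _ ((counit (R := k) (A := C)).lTensor _
      (f.toComoduleHom.linear.rTensor C x)) =
    f.toComoduleHom.linear (TensorProduct.rid k _ ((counit (R := k) (A := C)).lTensor _ x))
  induction x with
  | zero => simp
  | add x y hx hy => simp only [map_add, hx, hy]
  | tmul m c => simp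

theorem coactHom_counitHom (M : EntwinedModule E) :
    E.forgetToModule.map (coactHom M) ≫ counitHom M =
      E.forgetToModule.map (𝟙 M) := by
  ext m
  exact M.toComodule.counital m

variable (E) in
/-- The splitting of the coactions obtained from an `H`-separability datum. -/
noncomputable def splittingOfSeparable
    (P : ∀ X Y : EntwinedModule E, (E.forgetToModule.obj X ⟶ E.forgetToModule.obj Y) →
      (E.forgetToComodule.obj X ⟶ E.forgetToComodule.obj Y))
    (hP : ∀ (X Y Z T : EntwinedModule E) (u : X ⟶ Y)
      (h : E.forgetToModule.obj Y ⟶ E.forgetToModule.obj Z) (w : Z ⟶ T),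
      P X T (E.forgetToModule.map u ≫ h ≫ E.forgetToModule.map w) =
        E.forgetToComodule.map u ≫ P Y Z h ≫ E.forgetToComodule.map w)
    (hP' : ∀ (X Y : EntwinedModule E) (f : X ⟶ Y),
      P X Y (E.forgetToModule.map f) = E.forgetToComodule.map f) : CoactionSplitting E where
  map M := (P _ M (counitHom M)).linear ∘ₗ (E.tensorEquiv _).toLinearMap
  naturality {M N} f x := by
    -- Naturality of `P` in its source and in its target evaluates it on the two sides of the
    -- naturality square of the counit.
    have h₁ := hP _ _ _ _ (tensorMap (E.forgetToModule.map f).hom)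
      (counitHom N) (𝟙 N)
    have h₂ := hP _ _ _ _ (𝟙 _) (counitHom M) f
    rw [E.forgetToModule.map_id, E.forgetToComodule.map_id, Category.comp_id, Category.comp_id]
      at h₁
    rw [E.forgetToModule.map_id, E.forgetToComodule.map_id, Category.id_comp, Category.id_comp]
      at h₂
    rw [counitHom_naturality, h₂] at h₁
    have h := congrArg (fun g => RightComodule.Hom.linear g (E.tensorEquiv _ x)) h₁
    exact h.symm
  colinear M x := by
    let l : (E.tensorObj M.toComodule.carrier).toComodule.carrier →ₗ[k] M.toComodule.carrier :=
      (P _ M (counitHom M)).linear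
    refine ((P _ M (counitHom M)).colinear (E.tensorEquiv _ x)).trans ?_
    change l.rTensor C ((E.tensorObj _).toComodule.coact (E.tensorEquiv _ x)) =
      (l ∘ₗ (E.tensorEquiv _).toLinearMap).rTensor C _
    rw [LinearMap.rTensor_comp_apply, coact_tensorEquiv]
  map_coact M m := by
    -- The triangle identity of the first adjunction: the counit after the coaction is `F(𝟙)`, which
    -- `P` sends to the identity.
    have h₁ := hP _ _ _ _ (coactHom M) (counitHom M) (𝟙 M)
    rw [E.forgetToModule.map_id, E.forgetToComodule.map_id, Category.comp_id, Category.comp_id]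
      at h₁
    rw [coactHom_counitHom, hP'] at h₁
    exact (congrArg (fun g => RightComodule.Hom.linear g m) h₁).symm

namespace CoactionSplitting

variable (S : CoactionSplitting E)

/-- The `k`-linear map `x ↦ S(h(x₀) ⊗ x₁)`. -/
noncomputable def extend {X Y : EntwinedModule E}
    (h : X.toComodule.carrier →ₗ[Aᵐᵒᵖ] Y.toComodule.carrier) :
    X.toComodule.carrier →ₗ[k] Y.toComodule.carrier :=
  S.map Y ∘ₗ (h.restrictScalars k).rTensor C ∘ₗ X.toComodule.coact

theorem extend_colinear {X Y : EntwinedModule E}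
    (h : X.toComodule.carrier →ₗ[Aᵐᵒᵖ] Y.toComodule.carrier) (x : X.toComodule.carrier) :
    Y.toComodule.coact (S.extend h x) = (S.extend h).rTensor C (X.toComodule.coact x) := by
  simp only [extend, LinearMap.comp_apply]
  rw [S.colinear, LinearMap.rTensor_comp_apply, LinearMap.rTensor_comp_apply]
  congr 1
  rw [← LinearMap.comp_apply (LinearMap.lTensor _ _), LinearMap.lTensor_comp_rTensor,
    ← LinearMap.rTensor_comp_lTensor, LinearMap.comp_apply, ← X.toComodule.coassoc]
  generalize X.toComodule.coact.rTensor C (X.toComodule.coact x) = t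
  induction t with
  | zero => simp
  | add x y hx hy => simp only [map_add, hx, hy]
  | tmul s c =>
    induction s with
    | zero => simp
    | add x y hx hy => simp only [add_tmul, map_add, hx, hy]
    | tmul n d => simp

/-- `S.extend h` as a `C`-colinear map. -/
noncomputable def extendHom {X Y : EntwinedModule E}
    (h : X.toComodule.carrier →ₗ[Aᵐᵒᵖ] Y.toComodule.carrier) : X.toComodule ⟶ Y.toComodule :=
  RightComodule.Hom.mk (S.extend h) (S.extend_colinear h)

theorem extendHom_comp {X Y Z T : EntwinedModule E} (u : X ⟶ Y)
    (h : E.forgetToModule.obj Y ⟶ E.forgetToModule.obj Z) (w : Z ⟶ T) :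
    S.extendHom (E.forgetToModule.map u ≫ h ≫ E.forgetToModule.map w).hom =
      u.toComoduleHom ≫ S.extendHom (X := Y) (Y := Z) h.hom ≫ w.toComoduleHom := by
  refine RightComodule.Hom.ext (LinearMap.ext fun x => ?_)
  let h' : Y.toComodule.carrier →ₗ[Aᵐᵒᵖ] Z.toComodule.carrier := h.hom
  change S.map T ((w.toComoduleHom.linear ∘ₗ h'.restrictScalars k ∘ₗ
      u.toComoduleHom.linear).rTensor C (X.toComodule.coact x)) =
    w.toComoduleHom.linear (S.map Z ((h'.restrictScalars k).rTensor C
      (Y.toComodule.coact (u.toComoduleHom.linear x))))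
  rw [u.toComoduleHom.colinear, ← S.naturality, LinearMap.rTensor_comp_apply,
    LinearMap.rTensor_comp_apply]

theorem extendHom_map {X Y : EntwinedModule E} (f : X ⟶ Y) :
    S.extendHom (E.forgetToModule.map f).hom = f.toComoduleHom := by
  refine RightComodule.Hom.ext (LinearMap.ext fun x => ?_)
  change S.map Y (f.toComoduleHom.linear.rTensor C (X.toComodule.coact x)) =
    f.toComoduleHom.linear x
  rw [← f.toComoduleHom.colinear, S.map_coact]

theorem isHSeparable (S : CoactionSplitting E) : IsHSeparable E.forgetToModule E.forgetToComodule :=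
  ⟨fun _ _ h => S.extendHom h.hom, fun _ _ _ _ u h w => S.extendHom_comp u h w,
    fun _ _ f => S.extendHom_map f⟩

variable {S}

theorem IsLinear.isSeparableFunctor (hS : S.IsLinear) : IsSeparableFunctor E.forgetToModule := by
  have hlin : ∀ (X Y : EntwinedModule E)
      (h : X.toComodule.carrier →ₗ[Aᵐᵒᵖ] Y.toComodule.carrier) (a : Aᵐᵒᵖ)
      (x : X.toComodule.carrier), S.extend h (a • x) = a • S.extend h x := by
    intro X Y h a x
    have hx := X.compat x a.unop
    rw [MulOpposite.op_unop] at hx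
    simp only [extend, LinearMap.comp_apply]
    rw [hx, E.rTensor_tensorAction, hS, MulOpposite.op_unop]
  refine ⟨fun X Y h => EntwinedModule.Hom.mk (S.extendHom h.hom) (hlin X Y h.hom),
    fun X Y Z T u h w => ?_, fun X Y f => ?_⟩
  · exact EntwinedModule.Hom.ext (S.extendHom_comp u h w)
  · exact EntwinedModule.Hom.ext (S.extendHom_map f)

end CoactionSplitting

/-- Forgetting the action turns a separability datum into an `H`-separability datum. Its splitting
is `A`-linear because the value of `P` on each counit is already a morphism of entwined modules. -/
theorem exists_isLinear_splitting (hF : IsSeparableFunctor E.forgetToModule) :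
    ∃ S : CoactionSplitting E, S.IsLinear := by
  obtain ⟨P, hP, hP'⟩ := hF
  refine ⟨E.splittingOfSeparable (fun X Y h => E.forgetToComodule.map (P X Y h))
    (fun X Y Z T u h w => ?_) (fun X Y f => ?_), fun M x a => ?_⟩
  · exact (congrArg _ (hP X Y Z T u h w)).trans (by simp only [Functor.map_comp, Functor.id_map])
  · exact congrArg _ (hP' X Y f)
  · exact (P _ M (counitHom M)).map_op_smul (MulOpposite.op a)
      (E.tensorEquiv _ x)

end Rafael

end EntwiningStructure

open EntwiningStructure in
theorem theorem4 {k : Type u} [CommRing k] {A : Type v} [Ring A] [Algebra k A]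
    {C : Type v} [AddCommGroup C] [Module k C] [Coalgebra k C]
    (E : EntwiningStructure k A C) (θ : C ⊗[k] C →ₗ[k] A) (z : A ⊗[k] C)
    (hθz : E.IsFrobeniusSystem θ z) :
    (IsHSeparable E.forgetToModule E.forgetToComodule ↔
      ∃ β : C →ₗ[k] A, ∀ c : C, E.separabilityMap θ β c = 1 ⊗ₜ[k] c) ∧
    (IsSeparableFunctor E.forgetToModule ↔
      ∃ β : C →ₗ[k] A, (∀ c : C, E.separabilityMap θ β c = 1 ⊗ₜ[k] c) ∧
        ∀ (c : C) (a : A),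
          β c * a = LinearMap.mul' k A (β.lTensor A (E.ψ (c ⊗ₜ[k] a)))) := by
  refine ⟨⟨fun ⟨P, hP, hP'⟩ => ?_, fun ⟨β, hβ⟩ => (hθz.splitting hβ).isHSeparable⟩,
    fun h => ?_, fun ⟨β, hβ, hβ'⟩ =>
      CoactionSplitting.IsLinear.isSeparableFunctor (hθz.splitting_isLinear hβ hβ')⟩
  · exact ⟨_, (E.splittingOfSeparable P hP hP').separabilityMap_beta hθz⟩
  · obtain ⟨S, hS⟩ := exists_isLinear_splitting h
    exact ⟨_, S.separabilityMap_beta hθz, S.isIntertwining_beta hθz hS⟩
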